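/- Conventions. A topological space $Y$ is Menger if for every sequence $(\mathcal U_n)_{n\in\omega}$ of open covers of $Y$ there are finite $\mathcal V_n\subseteq\mathcal U_n$ such that $\bigcup_n\mathcal V_n$ covers $Y$. $K(Y)$ denotes the space of all nonempty compact subsets of $Y$ with the Vietoris topology; for $X\subseteq Z$ we regard $K(X)=\{K\in K(Z):K\subseteq X\}$ as a subspace of $K(Z)$. For a space $Z$ and a subspace $X\subseteq Z$, the $k$-Porada game $kP(Z,X)$ has innings $n\in\omega$: player I picks a nonempty compact set $K_n\subseteq X$ and an open set $U_n\subseteq Z$ with $K_n\subseteq U_n$ and, if $n\ge 1$, $U_n\subseteq V_{n-1}$; player II answers with an open set $V_n\subseteq Z$ such that $K_n\subseteq V_n\subseteq U_n$. Player II wins the run if $\emptyset\ne\bigcap_{n}U_n\subseteq X$; otherwise player I wins. The Porada game $P(Z,X)$ is the same game except that player I picks points $x_n\in X$ in place of the sets $K_n$, with the conditions $x_n\in U_n$ and $x_n\in V_n$. A strategy of player I assigns a legal move of player I to every finite sequence of legal moves of player II made against it (in particular, it provides a legal first move, so player I has no strategy if $X=\emptyset$); it is winning if player I wins every run played according to it.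 Theorem. Let $X$ be a subspace of a compact Hausdorff space $Z$. The following conditions are equivalent: (a) player I has a winning strategy in the game $kP(Z,X)$; (b) player I has a winning strategy in the game $P(K(Z),K(X))$; (c) player I has a winning strategy in the game $kP(K(Z),K(X))$; (d) $Z\setminus X$ is not Menger; (e) $K(Z)\setminus K(X)$ is not Menger. -/

import Mathlib

/-- A topological space is *Menger* if for every sequence of open covers one can select finite
subfamilies whose union covers the space. -/
def IsMengerSpace (Y : Type*) [TopologicalSpace Y] : Prop :=
  ∀ 𝒰 : ℕ → Set (Set Y), (∀ n, (∀ U ∈ 𝒰 n, IsOpen U) ∧ ⋃₀ 𝒰 n = Set.univ) →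
    ∃ 𝒱 : ℕ → Set (Set Y), (∀ n, (𝒱 n).Finite ∧ 𝒱 n ⊆ 𝒰 n) ∧ ⋃₀ (⋃ n, 𝒱 n) = Set.univ

namespace PoradaGame

/-! Both games are played on a space `Z` as follows. In inning `n` player I picks a pair `(aₙ, Uₙ)`
with `core aₙ ⊆ Uₙ`, with `Uₙ` open and, for `n ≥ 1`, `Uₙ ⊆ Vₙ₋₁`; player II answers with an open
set `Vₙ` with `core aₙ ⊆ Vₙ ⊆ Uₙ`. In the Porada game `aₙ` is a point of `X` and `core aₙ` is its
singleton; in the `k`-Porada game `aₙ` is a nonempty compact subset of `X`.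

A history is the list of the moves of player II made so far, the latest move first. A strategy of
player I is a map from histories to moves of player I (only its values at admissible histories
matter). -/

variable {Z : Type*} [TopologicalSpace Z] {α : Type*}

/-- The history of the first `n` moves of player II, the latest move first. -/
def history (V : ℕ → Set Z) : ℕ → List (Set Z)
  | 0 => []
  | n + 1 => V n :: history V n

/-- The history consists of legal moves of player II when player I plays by the strategy `s`. -/
def Admissible (core : α → Set Z) (s : List (Set Z) → α × Set Z) : List (Set Z) → Prop
  | [] => True
  | V :: h => Admissible core s h ∧ IsOpen V ∧ core (s h).1 ⊆ V ∧ V ⊆ (s h).2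

/-- At every admissible history the strategy `s` makes a legal move of player I. -/
def IsStrategy (core : α → Set Z) (s : List (Set Z) → α × Set Z) : Prop :=
  ∀ h, Admissible core s h →
    IsOpen (s h).2 ∧ core (s h).1 ⊆ (s h).2 ∧ ∀ V ∈ h.head?, (s h).2 ⊆ V

/-- `s` is a winning strategy of player I: it is a strategy, and in no infinite run played by it is
`⋂ Uₙ` a nonempty subset of `X` (which is the winning condition of player II). -/
def IsWinningStrategy (X : Set Z) (core : α → Set Z) (s : List (Set Z) → α × Set Z) : Prop :=
  IsStrategy core s ∧ ∀ V : ℕ → Set Z, (∀ n, Admissible core s (history V n)) →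
    ¬ ((⋂ n, (s (history V n)).2).Nonempty ∧ (⋂ n, (s (history V n)).2) ⊆ X)

/-- Player I has a winning strategy in the Porada game on `Z` with values in `X`. -/
def PlayerIWinsPorada (X : Set Z) : Prop :=
  ∃ s : List (Set Z) → X × Set Z, IsWinningStrategy X (fun x : X => {(x : Z)}) s

/-- Player I has a winning strategy in the `k`-Porada game on `Z` with values in `X`. -/
def PlayerIWinsKPorada (X : Set Z) : Prop :=
  ∃ s : List (Set Z) → {K : Set Z // IsCompact K ∧ K.Nonempty ∧ K ⊆ X} × Set Z,
    IsWinningStrategy X Subtype.val s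

end PoradaGame

/-- The hyperspace `K(X)` of nonempty compact subsets of `X`, as a subset of `K(Z)`. The space
`K(Z) = TopologicalSpace.NonemptyCompacts Z` carries the Vietoris topology of Mathlib. -/
def hyperspaceOf {Z : Type*} [TopologicalSpace Z] (X : Set Z) :
    Set (TopologicalSpace.NonemptyCompacts Z) :=
  {K | (K : Set Z) ⊆ X}

/-!
The equivalence rests on three facts about a subspace `X` of a compact Hausdorff space `Z`.

If `Xᶜ` is Menger, no strategy of player I in the `k`-Porada game on `(Z, X)` is winning
(`PoradaGame.PlayerIWinsKPorada.not_isMengerSpace`). Player II may always answer with an open set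
whose closure stays in the last move of player I and misses a given point of `Xᶜ`, so that the
complements of the closures of the possible answers cover `Xᶜ`. By Hurewicz's theorem (player I
does not win the Menger game on a Menger space) some run has answers whose closures have no point
of `Xᶜ` in common; their intersection is nonempty by compactness. The part of Hurewicz's theorem
that is needed is `IsMengerSpace.exists_branch`. It follows from
`exists_isOpen_subset_cofinite_level`: in the tree of increasing countable covers given by a
strategy, every point has a neighbourhood contained in all but finitely many sets of a given level.
The Menger property then selects a finite exceptional set on each level, and any branch that
avoids these sets covers the space.

If `Xᶜ` is not Menger, player I wins the Porada game on the hyperspace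
(`PoradaGame.playerIWinsPorada_hyperspaceOf`), by playing increasing compact sets that contain the
points missed by the covers which witness the failure of the Menger property. That strategy yields
winning strategies in the `k`-Porada games on the space and on the hyperspace.

If `Xᶜ` is Menger, so is the complement of the hyperspace of `X`
(`IsMengerSpace.compl_hyperspaceOf`), because it is an upper semicontinuous compact-valued image of
`Xᶜ`. The hyperspace is compact Hausdorff, so the first fact applies to it as well.
-/

open Set Filter Topology TopologicalSpace

/-! ### Menger subspaces in terms of open sets of the ambient space -/

theorem isMengerSpace_coe_iff {Z : Type*} [TopologicalSpace Z] {Y : Set Z} :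
    IsMengerSpace Y ↔
      ∀ 𝒰 : ℕ → Set (Set Z), (∀ n, (∀ U ∈ 𝒰 n, IsOpen U) ∧ Y ⊆ ⋃₀ 𝒰 n) →
        ∃ 𝒱 : ℕ → Set (Set Z), (∀ n, (𝒱 n).Finite ∧ 𝒱 n ⊆ 𝒰 n) ∧ Y ⊆ ⋃ n, ⋃₀ 𝒱 n := by
  constructor
  · intro h 𝒰 h𝒰
    obtain ⟨𝒱, h𝒱, hcov⟩ := h (fun n => (fun U : Set Z => ((↑) ⁻¹' U : Set Y)) '' 𝒰 n) (by
      refine fun n => ⟨?_, ?_⟩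
      · rintro _ ⟨U, hU, rfl⟩
        exact ((h𝒰 n).1 U hU).preimage continuous_subtype_val
      · refine eq_univ_of_forall fun y => ?_
        obtain ⟨U, hU, hyU⟩ := (h𝒰 n).2 y.2
        exact ⟨_, ⟨U, hU, rfl⟩, hyU⟩)
    have hlift : ∀ n, ∃ 𝒲 ⊆ 𝒰 n, 𝒲.Finite ∧
        (fun U : Set Z => ((↑) ⁻¹' U : Set Y)) '' 𝒲 = 𝒱 n := fun n =>
      exists_subset_image_finite_and.1 ⟨𝒱 n, (h𝒱 n).2, (h𝒱 n).1, rfl⟩ |>.imp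
        fun 𝒲 h => ⟨h.1, h.2.1, h.2.2.symm⟩
    choose 𝒲 hsub hfin heq using hlift
    refine ⟨𝒲, fun n => ⟨hfin n, hsub n⟩, fun y hy => ?_⟩
    obtain ⟨W, hW, hyW⟩ := hcov.symm.subset (mem_univ (⟨y, hy⟩ : Y))
    obtain ⟨n, hn⟩ := mem_iUnion.1 hW
    rw [← heq n] at hn
    obtain ⟨U, hU, rfl⟩ := hn
    exact mem_iUnion.2 ⟨n, U, hU, hyW⟩
  · intro h 𝒰 h𝒰
    obtain ⟨𝒱, h𝒱, hcov⟩ := h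
      (fun n => {U : Set Z | IsOpen U ∧ ((↑) ⁻¹' U : Set Y) ∈ 𝒰 n}) (by
        refine fun n => ⟨fun U hU => hU.1, fun y hy => ?_⟩
        obtain ⟨W, hW, hyW⟩ := (h𝒰 n).2.symm.subset (mem_univ (⟨y, hy⟩ : Y))
        obtain ⟨U, hU, rfl⟩ := isOpen_induced_iff.1 ((h𝒰 n).1 W hW)
        exact ⟨U, ⟨hU, hW⟩, hyW⟩)
    refine ⟨fun n => (fun U : Set Z => ((↑) ⁻¹' U : Set Y)) '' 𝒱 n,
      fun n => ⟨(h𝒱 n).1.image _, ?_⟩, eq_univ_of_forall fun y => ?_⟩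
    · rintro _ ⟨U, hU, rfl⟩
      exact ((h𝒱 n).2 hU).2
    · obtain ⟨n, U, hU, hyU⟩ := mem_iUnion.1 (hcov y.2)
      exact ⟨_, mem_iUnion.2 ⟨n, U, hU, rfl⟩, hyU⟩

/-- A Menger subspace is Lindelöf. -/
theorem IsMengerSpace.exists_countable_subcover {Z : Type*} [TopologicalSpace Z] {Y : Set Z}
    (hY : IsMengerSpace Y) {𝒰 : Set (Set Z)} (hopen : ∀ U ∈ 𝒰, IsOpen U) (hcov : Y ⊆ ⋃₀ 𝒰) :
    ∃ 𝒱 ⊆ 𝒰, 𝒱.Countable ∧ Y ⊆ ⋃₀ 𝒱 := by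
  obtain ⟨𝒱, h𝒱, hY𝒱⟩ := isMengerSpace_coe_iff.1 hY (fun _ => 𝒰) fun _ => ⟨hopen, hcov⟩
  refine ⟨⋃ n, 𝒱 n, iUnion_subset fun n => (h𝒱 n).2,
    countable_iUnion fun n => (h𝒱 n).1.countable, ?_⟩
  rwa [sUnion_iUnion]

/-! ### Hurewicz's theorem on trees of open sets -/

/-- The level-wise tail property behind Hurewicz's theorem: in a tree of open sets that increases
along the branches and among the successors of each node, and in which the successors of each node
cover `Y`, every point of `Y` has a neighbourhood contained in all but finitely many of the sets on
any given level. -/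
theorem exists_isOpen_subset_cofinite_level {Z : Type*} [TopologicalSpace Z] {Y : Set Z}
    {U : List ℕ → Set Z} (hopen : ∀ σ, IsOpen (U σ)) (hsucc : ∀ σ k, U σ ⊆ U (k :: σ))
    (hmono : ∀ σ, Monotone fun k => U (k :: σ)) (hcov : ∀ σ, Y ⊆ ⋃ k, U (k :: σ))
    {y : Z} (hy : y ∈ Y) (n : ℕ) :
    ∃ O, IsOpen O ∧ y ∈ O ∧ ∃ F : Set (List ℕ), F.Finite ∧
      ∀ σ, σ.length = n → σ ∉ F → O ⊆ U σ := by
  induction n with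
  | zero =>
    refine ⟨univ, isOpen_univ, mem_univ y, {[]}, finite_singleton _, fun σ hσ hσF => ?_⟩
    exact (hσF (List.length_eq_zero_iff.1 hσ)).elim
  | succ n ih =>
    obtain ⟨O, hO, hyO, F, hF, hOF⟩ := ih
    have hk : ∀ σ, ∃ k, y ∈ U (k :: σ) := fun σ => mem_iUnion.1 (hcov σ hy)
    choose k hk using hk
    -- Above a node outside `F` the set `O` still works; above a node `σ` of `F` only the
    -- successors with index below `k σ` are lost.
    refine ⟨O ∩ ⋂ σ ∈ F, U (k σ :: σ), hO.inter (hF.isOpen_biInter fun σ _ => hopen _),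
      ⟨hyO, mem_iInter₂.2 fun σ _ => hk σ⟩, ⋃ σ ∈ F, (fun j => j :: σ) '' Iio (k σ),
      hF.biUnion fun σ _ => (finite_Iio _).image _, ?_⟩
    rintro (_ | ⟨j, σ⟩) hlen hσ
    · simp at hlen
    by_cases hσF : σ ∈ F
    · have hj : k σ ≤ j := by
        by_contra! hlt
        exact hσ (mem_iUnion₂.2 ⟨σ, hσF, j, hlt, rfl⟩)
      exact fun z hz => hmono σ hj (mem_iInter₂.1 hz.2 σ hσF)
    · exact fun z hz => hsucc σ j (hOF σ (by simpa using hlen) hσF hz.1)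

/-- Hurewicz's theorem, for strategies in tree form: if `Y` is Menger, then some branch of the tree
covers `Y`. -/
theorem IsMengerSpace.exists_branch {Z : Type*} [TopologicalSpace Z] {Y : Set Z}
    (hY : IsMengerSpace Y) {U : List ℕ → Set Z} (hopen : ∀ σ, IsOpen (U σ))
    (hsucc : ∀ σ k, U σ ⊆ U (k :: σ)) (hmono : ∀ σ, Monotone fun k => U (k :: σ))
    (hcov : ∀ σ, Y ⊆ ⋃ k, U (k :: σ)) :
    ∃ (σ : ℕ → List ℕ) (k : ℕ → ℕ), σ 0 = [] ∧ (∀ n, σ (n + 1) = k n :: σ n) ∧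
      Y ⊆ ⋃ n, U (σ (n + 1)) := by
  obtain ⟨𝒱, h𝒱, hY𝒱⟩ := isMengerSpace_coe_iff.1 hY
    (fun n => {O | IsOpen O ∧ ∃ F : Set (List ℕ), F.Finite ∧
      ∀ σ, σ.length = n + 1 → σ ∉ F → O ⊆ U σ})
    (fun n => ⟨fun O hO => hO.1, fun y hy => by
      obtain ⟨O, hO, hyO, hF⟩ := exists_isOpen_subset_cofinite_level hopen hsucc hmono hcov hy (n + 1)
      exact ⟨O, ⟨hO, hF⟩, hyO⟩⟩)
  have hF : ∀ n, ∃ F : Set (List ℕ), F.Finite ∧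
      ∀ σ, σ.length = n + 1 → σ ∉ F → ⋃₀ 𝒱 n ⊆ U σ := fun n => by
    have h : ∀ O : 𝒱 n, ∃ F : Set (List ℕ), F.Finite ∧
        ∀ σ, σ.length = n + 1 → σ ∉ F → (O : Set Z) ⊆ U σ := fun O => ((h𝒱 n).2 O.2).2
    choose F hF hOF using h
    have := (h𝒱 n).1.to_subtype
    refine ⟨⋃ O, F O, finite_iUnion hF, fun σ hσ hσF => sUnion_subset fun O hO => ?_⟩
    exact hOF ⟨O, hO⟩ σ hσ fun h => hσF (mem_iUnion.2 ⟨_, h⟩)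
  choose F hF hFU using hF
  have hk : ∀ n (σ : List ℕ), ∃ k, k :: σ ∉ F n := fun n σ =>
    ((hF n).preimage (f := fun k => k :: σ) fun _ _ _ _ h => (List.cons.inj h).1).exists_notMem
  choose k hk using hk
  let σ : ℕ → List ℕ := fun n => Nat.rec [] (fun n τ => k n τ :: τ) n
  have hlen : ∀ n, (σ n).length = n := fun n => by
    induction n with
    | zero => rfl
    | succ n ih => exact congrArg Nat.succ ih
  refine ⟨σ, fun n => k n (σ n), rfl, fun n => rfl, fun y hy => ?_⟩
  obtain ⟨n, hn⟩ := mem_iUnion.1 (hY𝒱 hy)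
  exact mem_iUnion.2 ⟨n, hFU n (σ (n + 1)) (hlen (n + 1)) (hk n (σ n)) hn⟩

/-! ### The hyperspace of a Menger complement -/

/-- The set `(hyperspaceOf X)ᶜ` is the image of `Xᶜ` under the upper semicontinuous map that sends
`z` to the compact set of all `K` with `z ∈ K`, and images under such maps inherit the Menger
property. -/
theorem IsMengerSpace.compl_hyperspaceOf {Z : Type*} [TopologicalSpace Z] [CompactSpace Z]
    [T2Space Z] {X : Set Z} (hX : IsMengerSpace (Xᶜ : Set Z)) :
    IsMengerSpace ((hyperspaceOf X)ᶜ : Set (NonemptyCompacts Z)) := by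
  refine isMengerSpace_coe_iff.2 fun 𝒰 h𝒰 => ?_
  obtain ⟨𝒱, h𝒱, hcov⟩ := isMengerSpace_coe_iff.1 hX
    (fun n => {O | IsOpen O ∧ ∃ 𝒢 ⊆ 𝒰 n, 𝒢.Finite ∧
      ∀ K : NonemptyCompacts Z, ((K : Set Z) ∩ O).Nonempty → K ∈ ⋃₀ 𝒢})
    (fun n => ⟨fun O hO => hO.1, fun y hy => by
      have hc : IsCompact {K : NonemptyCompacts Z | ((K : Set Z) ∩ {y}).Nonempty} :=
        (NonemptyCompacts.isClosed_inter_nonempty_of_isClosed isClosed_singleton).isCompact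
      obtain ⟨𝒢, h𝒢, hfin, hsub⟩ := hc.elim_finite_subcover_image (c := id) (h𝒰 n).1 (by
        intro K hK
        refine (sUnion_eq_biUnion (s := 𝒰 n)).subset <| (h𝒰 n).2 fun hKX => hy (hKX ?_)
        obtain ⟨z, hz, rfl⟩ := hK
        exact hz)
      have hopen : IsOpen (⋃₀ 𝒢) := isOpen_sUnion fun U hU => (h𝒰 n).1 U (h𝒢 hU)
      -- The compact sets that escape `𝒢` have a compact union, and `y` is not in it.
      have hcl : IsClosed (⋃ K ∈ (⋃₀ 𝒢)ᶜ, ((K : NonemptyCompacts Z) : Set Z)) :=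
        (NonemptyCompacts.isCompact_biUnion_coe_of_isCompact hopen.isClosed_compl.isCompact).isClosed
      refine ⟨_, ⟨hcl.isOpen_compl, 𝒢, h𝒢, hfin, fun K hK => ?_⟩, fun hy' => ?_⟩
      · by_contra hK𝒢
        obtain ⟨z, hzK, hz⟩ := hK
        exact hz (mem_iUnion₂.2 ⟨K, hK𝒢, hzK⟩)
      · obtain ⟨K, hK, hyK⟩ := mem_iUnion₂.1 hy'
        have : K ∈ ⋃₀ 𝒢 := by
          rw [sUnion_eq_biUnion]
          exact hsub ⟨y, hyK, rfl⟩
        exact hK this⟩)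
  have h𝒢 : ∀ n, ∃ 𝒢 ⊆ 𝒰 n, 𝒢.Finite ∧
      ∀ K : NonemptyCompacts Z, ((K : Set Z) ∩ ⋃₀ 𝒱 n).Nonempty → K ∈ ⋃₀ 𝒢 := fun n => by
    have h : ∀ O : 𝒱 n, ∃ 𝒢 ⊆ 𝒰 n, 𝒢.Finite ∧
      ∀ K : NonemptyCompacts Z, ((K : Set Z) ∩ O).Nonempty → K ∈ ⋃₀ 𝒢 :=
        fun O => ((h𝒱 n).2 O.2).2
    choose 𝒢 hsub hfin hK using h
    have := (h𝒱 n).1.to_subtype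
    refine ⟨⋃ O, 𝒢 O, iUnion_subset hsub, finite_iUnion hfin, ?_⟩
    rintro K ⟨z, hzK, O, hO, hzO⟩
    exact sUnion_mono (subset_iUnion 𝒢 ⟨O, hO⟩) (hK ⟨O, hO⟩ K ⟨z, hzK, hzO⟩)
  choose 𝒢 hsub hfin hK using h𝒢
  refine ⟨𝒢, fun n => ⟨hfin n, hsub n⟩, fun K hKX => ?_⟩
  obtain ⟨z, hzK, hzX⟩ := not_subset.1 hKX
  obtain ⟨n, hn⟩ := mem_iUnion.1 (hcov hzX)
  exact mem_iUnion.2 ⟨n, hK n K ⟨z, hzK, hn⟩⟩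

/-! ### Strategies of player I when the complement is Menger -/

namespace PoradaGame

/-- Against a move `(K, U)` of player I, player II has a decreasing sequence of answers whose
closures stay in `U` and have no point of the Menger space `Xᶜ` in common. -/
theorem exists_antitone_answers {Z : Type*} [TopologicalSpace Z] [CompactSpace Z] [T2Space Z]
    {X : Set Z} (hX : IsMengerSpace (Xᶜ : Set Z)) {K U : Set Z} (hK : IsCompact K) (hKX : K ⊆ X)
    (hU : IsOpen U) (hKU : K ⊆ U) :
    ∃ V : ℕ → Set Z, (∀ k, IsOpen (V k) ∧ K ⊆ V k ∧ closure (V k) ⊆ U) ∧ Antitone V ∧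
      Xᶜ ⊆ ⋃ k, (closure (V k))ᶜ := by
  let S : Set (Set Z) := {V | IsOpen V ∧ K ⊆ V ∧ closure V ⊆ U}
  obtain ⟨V₀, hV₀⟩ : S.Nonempty := normal_exists_closure_subset hK.isClosed hU hKU
  obtain ⟨𝒱, h𝒱, hcount, hcov⟩ := hX.exists_countable_subcover
    (𝒰 := (fun V => (closure V)ᶜ) '' S)
    (by
      rintro _ ⟨V, -, rfl⟩
      exact isClosed_closure.isOpen_compl)
    (fun y hy => by
      obtain ⟨V, hV, hKV, hVU⟩ := normal_exists_closure_subset hK.isClosed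
        (hU.inter (isOpen_compl_singleton (x := y)))
        (subset_inter hKU fun z hz hzy => hy (mem_singleton_iff.1 hzy ▸ hKX hz))
      exact ⟨_, ⟨V, ⟨hV, hKV, hVU.trans inter_subset_left⟩, rfl⟩, fun h => (hVU h).2 rfl⟩)
  choose g hgS hg using fun W : 𝒱 => h𝒱 W.2
  have := hcount.to_subtype
  obtain ⟨f, hf⟩ := ((countable_range g).insert V₀).exists_eq_range (insert_nonempty _ _)
  have hfS : ∀ i, f i ∈ S := fun i => by
    have : f i ∈ insert V₀ (range g) := hf ▸ mem_range_self i
    rcases this with h | ⟨W, h⟩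
    · rwa [h]
    · exact h ▸ hgS W
  refine ⟨fun k => ⋂ i ∈ Iic k, f i, fun k => ⟨?_, ?_, ?_⟩, ?_, ?_⟩
  · exact (finite_Iic k).isOpen_biInter fun i _ => (hfS i).1
  · exact subset_iInter₂ fun i _ => (hfS i).2.1
  · exact (closure_mono (biInter_subset_of_mem (mem_Iic.2 (Nat.zero_le k)))).trans (hfS 0).2.2
  · exact fun k l hkl => biInter_subset_biInter_left (Iic_subset_Iic.2 hkl)
  · intro y hy
    obtain ⟨W, hW, hyW⟩ := hcov hy
    replace hyW := (hg ⟨W, hW⟩).symm.subset hyW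
    obtain ⟨k, hk⟩ : g ⟨W, hW⟩ ∈ range f := hf ▸ mem_insert_of_mem _ (mem_range_self _)
    simp only [← hk] at hyW
    exact mem_iUnion.2 ⟨k, fun h => hyW (closure_mono (biInter_subset_of_mem self_mem_Iic) h)⟩

/-- The answers of `exists_antitone_answers` to a strategy of player I form a tree; by Hurewicz's
theorem the complements of their closures cover `Xᶜ` along some branch, and the run along that
branch is won by player II. -/
theorem PlayerIWinsKPorada.not_isMengerSpace {Z : Type*} [TopologicalSpace Z] [CompactSpace Z]
    [T2Space Z] {X : Set Z} (h : PlayerIWinsKPorada X) : ¬ IsMengerSpace (Xᶜ : Set Z) := by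
  intro hX
  obtain ⟨s, hs, hwin⟩ := h
  have hN : ∀ h, ∃ V : ℕ → Set Z, Admissible Subtype.val s h →
      (∀ k, IsOpen (V k) ∧ ((s h).1 : Set Z) ⊆ V k ∧ closure (V k) ⊆ (s h).2) ∧ Antitone V ∧
      Xᶜ ⊆ ⋃ k, (closure (V k))ᶜ := fun h => by
    by_cases hh : Admissible Subtype.val s h
    · obtain ⟨V, hV⟩ := exists_antitone_answers hX (s h).1.2.1 (s h).1.2.2.2 (hs h hh).1
        (hs h hh).2.1
      exact ⟨V, fun _ => hV⟩
    · exact ⟨fun _ => ∅, fun h => (hh h).elim⟩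
  choose N hN using hN
  let H : List ℕ → List (Set Z) := fun σ => List.rec [] (fun k _ h => N h k :: h) σ
  have hH : ∀ σ, Admissible Subtype.val s (H σ) := fun σ => by
    induction σ with
    | nil => exact trivial
    | cons k σ ih =>
      have := (hN _ ih).1 k
      exact ⟨ih, this.1, this.2.1, subset_closure.trans this.2.2⟩
  let U : List ℕ → Set Z := fun σ => List.rec ∅ (fun k τ _ => (closure (N (H τ) k))ᶜ) σ
  obtain ⟨σ, k, hσ0, hσ, hcov⟩ := hX.exists_branch (U := U)
    (by
      rintro (_ | ⟨k, σ⟩)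
      · exact isOpen_empty
      · exact isClosed_closure.isOpen_compl)
    (by
      rintro (_ | ⟨j, σ⟩) k
      · exact empty_subset _
      · refine compl_subset_compl.2 (((hN _ (hH (j :: σ))).1 k).2.2.trans ?_)
        exact ((hs _ (hH (j :: σ))).2.2 _ rfl).trans subset_closure)
    (fun σ i j hij => compl_subset_compl.2 (closure_mono ((hN _ (hH σ)).2.1 hij)))
    (fun σ => (hN _ (hH σ)).2.2)
  let V : ℕ → Set Z := fun n => N (H (σ n)) (k n)
  have hhist : ∀ n, history V n = H (σ n) := fun n => by
    induction n with
    | zero => rw [hσ0]; rfl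
    | succ n ih => rw [hσ n]; exact congrArg (V n :: ·) ih
  have hadm : ∀ n, Admissible Subtype.val s (history V n) := fun n => hhist n ▸ hH _
  have hV : ∀ n, ((s (history V n)).1 : Set Z) ⊆ V n ∧ closure (V n) ⊆ (s (history V n)).2 :=
    fun n => by
      rw [hhist n]
      exact ((hN _ (hH (σ n))).1 (k n)).2
  have hUV : ∀ n, (s (history V (n + 1))).2 ⊆ V n := fun n => (hs _ (hadm (n + 1))).2.2 _ rfl
  refine hwin V hadm ⟨?_, fun z hz => ?_⟩
  · have hne := IsCompact.nonempty_iInter_of_sequence_nonempty_isCompact_isClosed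
      (fun n => closure (V n))
      (fun n => (hV (n + 1)).2.trans ((hUV n).trans subset_closure))
      (fun n => ((s (history V n)).1.2.2.1.mono (hV n).1).closure)
      isClosed_closure.isCompact (fun n => isClosed_closure)
    exact hne.mono (iInter_mono fun n => (hV n).2)
  · by_contra hzX
    obtain ⟨n, hn⟩ := mem_iUnion.1 (hcov hzX)
    rw [hσ n] at hn
    exact hn (subset_closure (hUV n (mem_iInter.1 hz (n + 1))))

end PoradaGame

/-! ### A strategy of player I in the Porada game on the hyperspace -/

theorem TopologicalSpace.NonemptyCompacts.exists_isOpen_forall_mem {Z : Type*}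
    [TopologicalSpace Z] {𝒱 : Set (NonemptyCompacts Z)} (h𝒱 : IsOpen 𝒱) {K : NonemptyCompacts Z}
    (hK : K ∈ 𝒱) :
    ∃ O : Set Z, IsOpen O ∧ (K : Set Z) ⊆ O ∧
      ∀ L : NonemptyCompacts Z, (K : Set Z) ⊆ L → (L : Set Z) ⊆ O → L ∈ 𝒱 := by
  obtain ⟨_, ⟨u, ⟨-, -, hu⟩, rfl⟩, hKu, hsub⟩ :=
    NonemptyCompacts.isTopologicalBasis.exists_subset_of_mem_open hK h𝒱
  exact ⟨⋃₀ u, isOpen_sUnion hu, hKu.1, fun L hKL hLO =>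
    hsub ⟨hLO, fun U hU => (hKu.2 U hU).mono (inter_subset_inter_left _ hKL)⟩⟩

namespace PoradaGame

/-- The data that player I keeps in the Porada game on the hyperspace: the set `K` to be played,
the part `F` of `Z` not yet covered by the finite families selected so far, and an open set `W`
that bounds all sets to be played later. -/
structure CoverState {Z : Type*} [TopologicalSpace Z] (X : Set Z) where
  /-- the next set to be played -/
  K : hyperspaceOf X
  /-- the part of the space that is not covered yet -/
  F : Set Z
  /-- an open bound for the sets to be played -/
  W : Set Z

/-- The invariant of `CoverState`: `K` and `F` lie in the open set `W`, and the family `𝒰` still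
to be used covers the part of the closed set `F` outside `K`. -/
structure CoverState.Good {Z : Type*} [TopologicalSpace Z] {X : Set Z} (𝒰 : Set (Set Z))
    (p : CoverState X) : Prop where
  isClosed : IsClosed p.F
  isOpen : IsOpen p.W
  K_subset : ((p.K : NonemptyCompacts Z) : Set Z) ⊆ p.W
  F_subset : p.F ⊆ p.W
  diff_subset : p.F \ ⋃₀ 𝒰 ⊆ ((p.K : NonemptyCompacts Z) : Set Z)

/-- The passage from `p` to `q` is a correct reaction to the answer `𝒱` of player II: a finite part
of `𝒰` is removed from `F`, and all compact sets between `K` and the closure of the new bound are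
members of `𝒱`. -/
structure CoverState.Step {Z : Type*} [TopologicalSpace Z] {X : Set Z} (𝒰 : Set (Set Z))
    (𝒱 : Set (NonemptyCompacts Z)) (p q : CoverState X) : Prop where
  K_subset : ((p.K : NonemptyCompacts Z) : Set Z) ⊆ (q.K : NonemptyCompacts Z)
  W_subset : q.W ⊆ p.W
  mem : ∀ L : NonemptyCompacts Z, ((p.K : NonemptyCompacts Z) : Set Z) ⊆ L →
    (L : Set Z) ⊆ closure q.W → L ∈ 𝒱
  F_eq : ∃ 𝒢 ⊆ 𝒰, 𝒢.Finite ∧ q.F = p.F \ ⋃₀ 𝒢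

theorem CoverState.Good.exists_step {Z : Type*} [TopologicalSpace Z] [CompactSpace Z] [T2Space Z]
    {X : Set Z} {𝒰 𝒰' : Set (Set Z)} (hopen : ∀ U ∈ 𝒰, IsOpen U) (hopen' : ∀ U ∈ 𝒰', IsOpen U)
    (hcov' : Xᶜ ⊆ ⋃₀ 𝒰') {p : CoverState X} (hp : p.Good 𝒰) {𝒱 : Set (NonemptyCompacts Z)}
    (h𝒱 : IsOpen 𝒱) (hK : (p.K : NonemptyCompacts Z) ∈ 𝒱) :
    ∃ q : CoverState X, q.Good 𝒰' ∧ p.Step 𝒰 𝒱 q := by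
  obtain ⟨O, hO, hKO, hOmem⟩ := NonemptyCompacts.exists_isOpen_forall_mem h𝒱 hK
  obtain ⟨W, hW, hKW, hWsub⟩ := normal_exists_closure_subset
    (p.K : NonemptyCompacts Z).isCompact.isClosed (hO.inter hp.isOpen)
    (subset_inter hKO hp.K_subset)
  obtain ⟨𝒢, h𝒢, hfin, hFW⟩ := (hp.isClosed.sdiff hW).isCompact.elim_finite_subcover_image
    (c := id) hopen (fun z hz => (sUnion_eq_biUnion (s := 𝒰)).subset <| by
      by_contra hz𝒰
      exact hz.2 (hKW (hp.diff_subset ⟨hz.1, hz𝒰⟩)))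
  have hF : IsClosed (p.F \ ⋃₀ 𝒢) :=
    hp.isClosed.sdiff (isOpen_sUnion fun U hU => hopen U (h𝒢 hU))
  have hFW' : p.F \ ⋃₀ 𝒢 ⊆ W := fun z hz => by
    by_contra hzW
    exact hz.2 ((sUnion_eq_biUnion (s := 𝒢)).symm.subset (hFW ⟨hz.1, hzW⟩))
  let K' : NonemptyCompacts Z :=
    ⟨⟨(p.K : NonemptyCompacts Z) ∪ ((p.F \ ⋃₀ 𝒢) \ ⋃₀ 𝒰'),
      (p.K : NonemptyCompacts Z).isCompact.union (hF.sdiff (isOpen_sUnion hopen')).isCompact⟩,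
      (p.K : NonemptyCompacts Z).nonempty.mono subset_union_left⟩
  have hK'X : K' ∈ hyperspaceOf X := by
    refine union_subset p.K.2 fun z hz => ?_
    by_contra hzX
    exact hz.2 (hcov' hzX)
  exact ⟨⟨⟨K', hK'X⟩, p.F \ ⋃₀ 𝒢, W⟩,
    ⟨hF, hW, union_subset hKW (sdiff_subset.trans hFW'), hFW', subset_union_right⟩,
    ⟨subset_union_left, subset_closure.trans (hWsub.trans inter_subset_right),
      fun L hKL hL => hOmem L hKL (hL.trans (hWsub.trans inter_subset_left)),
      𝒢, h𝒢, hfin, rfl⟩⟩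

/-- Given open covers `𝒰 n` of `Xᶜ` without a finite selection that covers `Xᶜ`, player I plays an
increasing sequence of compact sets, the `n`-th of which contains the points covered neither by the
families selected so far nor by `𝒰 n`. Every answer of player II contains all compact sets between
the last set played and some open bound `W` of it, and a finite part of `𝒰 n` is selected that
covers, of the points not yet covered, those outside `W`. In the end the intersection of the bounds
`W` is a compact set that belongs to all answers of player II and contains the points of `Xᶜ` missed
by the selection. -/
theorem playerIWinsPorada_hyperspaceOf {Z : Type*} [TopologicalSpace Z] [CompactSpace Z]
    [T2Space Z] {X : Set Z} (hX : ¬ IsMengerSpace (Xᶜ : Set Z)) :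
    PlayerIWinsPorada (hyperspaceOf X) := by
  rw [isMengerSpace_coe_iff] at hX
  push Not at hX
  obtain ⟨𝒰, h𝒰, hsel⟩ := hX
  obtain ⟨x, hx⟩ : X.Nonempty := by
    by_contra! hXe
    subst hXe
    have h : ∀ n, ∃ 𝒢 ⊆ 𝒰 n, 𝒢.Finite ∧ (univ : Set Z) ⊆ ⋃ U ∈ 𝒢, id U := fun n =>
      isCompact_univ.elim_finite_subcover_image (h𝒰 n).1
        (by simpa [sUnion_eq_biUnion] using (h𝒰 n).2)
    choose 𝒢 hsub hfin hcov using h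
    refine hsel 𝒢 (fun n => ⟨hfin n, hsub n⟩) fun z _ => mem_iUnion.2 ⟨0, ?_⟩
    exact (sUnion_eq_biUnion (s := 𝒢 0)).symm.subset (hcov 0 (mem_univ z))
  let K₀ : NonemptyCompacts Z :=
    ⟨⟨{x} ∪ (⋃₀ 𝒰 0)ᶜ, isCompact_singleton.union
      (isOpen_sUnion (h𝒰 0).1).isClosed_compl.isCompact⟩, ⟨x, Or.inl rfl⟩⟩
  let p₀ : CoverState X :=
    ⟨⟨K₀, union_subset (singleton_subset_iff.2 hx) (compl_subset_comm.1 (h𝒰 0).2)⟩, univ, univ⟩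
  have hp₀ : p₀.Good (𝒰 0) := ⟨isClosed_univ, isOpen_univ, subset_univ _, subset_univ _,
    fun z hz => Or.inr hz.2⟩
  have hnext : ∀ n (𝒱 : Set (NonemptyCompacts Z)) (p : CoverState X), ∃ q : CoverState X,
      p.Good (𝒰 n) → IsOpen 𝒱 → (p.K : NonemptyCompacts Z) ∈ 𝒱 →
        q.Good (𝒰 (n + 1)) ∧ p.Step (𝒰 n) 𝒱 q := fun n 𝒱 p => by
    by_cases h : p.Good (𝒰 n) ∧ IsOpen 𝒱 ∧ (p.K : NonemptyCompacts Z) ∈ 𝒱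
    · obtain ⟨q, hq⟩ := h.1.exists_step (h𝒰 n).1 (h𝒰 (n + 1)).1 (h𝒰 (n + 1)).2 h.2.1 h.2.2
      exact ⟨q, fun _ _ _ => hq⟩
    · exact ⟨p, fun h₁ h₂ h₃ => (h ⟨h₁, h₂, h₃⟩).elim⟩
  choose next hnext using hnext
  let st : List (Set (NonemptyCompacts Z)) → CoverState X :=
    fun h => List.rec p₀ (fun 𝒱 h p => next h.length 𝒱 p) h
  let s : List (Set (NonemptyCompacts Z)) → hyperspaceOf X × Set (NonemptyCompacts Z) :=
    fun h => ((st h).K, h.head?.getD univ)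
  have hgood : ∀ h, Admissible (fun K : hyperspaceOf X => {(K : NonemptyCompacts Z)}) s h →
      (st h).Good (𝒰 h.length) := fun h hh => by
    induction h with
    | nil => exact hp₀
    | cons 𝒱 h ih => exact (hnext _ 𝒱 _ (ih hh.1) hh.2.1 (singleton_subset_iff.1 hh.2.2.1)).1
  have hstep : ∀ 𝒱 h, Admissible (fun K : hyperspaceOf X => {(K : NonemptyCompacts Z)}) s (𝒱 :: h) →
      (st h).Step (𝒰 h.length) 𝒱 (st (𝒱 :: h)) := fun 𝒱 h hh =>
    (hnext _ 𝒱 _ (hgood h hh.1) hh.2.1 (singleton_subset_iff.1 hh.2.2.1)).2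
  refine ⟨s, fun h hh => ?_, fun V hV => ?_⟩
  · rcases h with _ | ⟨𝒱, h⟩
    · exact ⟨isOpen_univ, subset_univ _, fun V hV => by simp at hV⟩
    · refine ⟨hh.2.1, singleton_subset_iff.2 ?_, fun V hV => ?_⟩
      · exact (hstep 𝒱 h hh).mem _ (hstep 𝒱 h hh).K_subset
          ((hgood _ hh).K_subset.trans subset_closure)
      · obtain rfl : 𝒱 = V := by simpa using hV
        exact subset_rfl
  rintro ⟨-, hVX⟩
  let p : ℕ → CoverState X := fun n => st (history V n)
  have hlen : ∀ n, (history V n).length = n := fun n => by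
    induction n with
    | zero => rfl
    | succ n ih => exact congrArg Nat.succ ih
  have hp : ∀ n, (p n).Good (𝒰 n) := fun n => by simpa only [hlen] using hgood _ (hV n)
  have hpp : ∀ n, (p n).Step (𝒰 n) (V n) (p (n + 1)) := fun n => by
    have := hstep (V n) (history V n) (hV (n + 1))
    rwa [hlen] at this
  have hW : Antitone fun n => (p n).W := antitone_nat_of_succ_le fun n => (hpp n).W_subset
  have hK : Monotone fun n => (((p n).K : NonemptyCompacts Z) : Set Z) :=
    monotone_nat_of_le_succ fun n => (hpp n).K_subset
  have hKL : ∀ n, (((p n).K : NonemptyCompacts Z) : Set Z) ⊆ ⋂ m, closure (p m).W := fun n =>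
    subset_iInter fun m => (hK (le_max_left n m)).trans <| (hp _).K_subset.trans <|
      (hW (le_max_right n m)).trans subset_closure
  let L : NonemptyCompacts Z := ⟨⟨⋂ m, closure (p m).W,
    (isClosed_iInter fun m => isClosed_closure).isCompact⟩,
    ((p 0).K : NonemptyCompacts Z).nonempty.mono (hKL 0)⟩
  have hL : L ∈ hyperspaceOf X := hVX <| mem_iInter.2 fun n => by
    rcases n with _ | n
    · exact mem_univ L
    · exact (hpp n).mem L (hKL n) (iInter_subset _ (n + 1))
  choose 𝒢 hsub hfin hF using fun n => (hpp n).F_eq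
  obtain ⟨y, hyX, hy⟩ := not_subset.1 (hsel 𝒢 fun n => ⟨hfin n, hsub n⟩)
  have hyF : ∀ n, y ∈ (p n).F := fun n => by
    induction n with
    | zero => exact mem_univ y
    | succ n ih =>
      rw [hF n]
      exact ⟨ih, fun h => hy (mem_iUnion.2 ⟨n, h⟩)⟩
  exact hyX (hL (mem_iInter.2 fun n => subset_closure ((hp n).F_subset (hyF n))))

/-! ### Comparison of the games -/

/-- Points may be replaced by singletons. -/
theorem PlayerIWinsPorada.playerIWinsKPorada {Z : Type*} [TopologicalSpace Z] {X : Set Z}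
    (h : PlayerIWinsPorada X) : PlayerIWinsKPorada X := by
  obtain ⟨s, hs, hwin⟩ := h
  let t : List (Set Z) → {K : Set Z // IsCompact K ∧ K.Nonempty ∧ K ⊆ X} × Set Z := fun h =>
    (⟨{((s h).1 : Z)}, isCompact_singleton, singleton_nonempty _,
      singleton_subset_iff.2 (s h).1.2⟩, (s h).2)
  have hadm : ∀ h, Admissible Subtype.val t h → Admissible (fun x : X => {(x : Z)}) s h :=
    fun h hh => by
      induction h with
      | nil => exact trivial
      | cons V h ih => exact ⟨ih hh.1, hh.2⟩
  exact ⟨t, fun h hh => hs h (hadm h hh), fun V hV => hwin V fun n => hadm _ (hV n)⟩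

/-- Player I translates an answer `V` of player II in the space to an open set of compact subsets
of `V` whose closure lies in the last move; by compactness the intersection of these is nonempty,
so that the strategy on the hyperspace provides a compact set that lies in all `V` but not in
`X`. -/
theorem PlayerIWinsPorada.playerIWinsKPorada_of_hyperspaceOf {Z : Type*} [TopologicalSpace Z]
    [CompactSpace Z] [T2Space Z] {X : Set Z} (h : PlayerIWinsPorada (hyperspaceOf X)) :
    PlayerIWinsKPorada X := by
  obtain ⟨s, hs, hwin⟩ := h
  have hN : ∀ (V : Set Z) (h : List (Set (NonemptyCompacts Z))), ∃ 𝒱 : Set (NonemptyCompacts Z),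
      IsOpen (s h).2 → ((s h).1 : NonemptyCompacts Z) ∈ (s h).2 → IsOpen V →
      (((s h).1 : NonemptyCompacts Z) : Set Z) ⊆ V →
        IsOpen 𝒱 ∧ ((s h).1 : NonemptyCompacts Z) ∈ 𝒱 ∧
          closure 𝒱 ⊆ (s h).2 ∩ {K | (K : Set Z) ⊆ V} := fun V h => by
    by_cases hh : IsOpen (s h).2 ∧ ((s h).1 : NonemptyCompacts Z) ∈ (s h).2 ∧ IsOpen V ∧
      (((s h).1 : NonemptyCompacts Z) : Set Z) ⊆ V
    · obtain ⟨𝒱, h₁, h₂, h₃⟩ := normal_exists_closure_subset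
        (isClosed_singleton (x := ((s h).1 : NonemptyCompacts Z)))
        (hh.1.inter (NonemptyCompacts.isOpen_subsets_of_isOpen hh.2.2.1))
        (singleton_subset_iff.2 ⟨hh.2.1, hh.2.2.2⟩)
      exact ⟨𝒱, fun _ _ _ _ => ⟨h₁, singleton_subset_iff.1 h₂, h₃⟩⟩
    · exact ⟨∅, fun h₁ h₂ h₃ h₄ => (hh ⟨h₁, h₂, h₃, h₄⟩).elim⟩
  choose N hN using hN
  let T : List (Set Z) → List (Set (NonemptyCompacts Z)) :=
    fun h => List.rec [] (fun V _ g => N V g :: g) h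
  let t : List (Set Z) → {K : Set Z // IsCompact K ∧ K.Nonempty ∧ K ⊆ X} × Set Z := fun h =>
    (⟨(((s (T h)).1 : NonemptyCompacts Z) : Set Z), NonemptyCompacts.isCompact _,
      NonemptyCompacts.nonempty _, (s (T h)).1.2⟩, h.head?.getD univ)
  have hTN : ∀ V h, Admissible (fun K : hyperspaceOf X => {(K : NonemptyCompacts Z)}) s (T h) →
      IsOpen V → (((s (T h)).1 : NonemptyCompacts Z) : Set Z) ⊆ V →
      IsOpen (N V (T h)) ∧ ((s (T h)).1 : NonemptyCompacts Z) ∈ N V (T h) ∧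
        closure (N V (T h)) ⊆ (s (T h)).2 ∩ {K | (K : Set Z) ⊆ V} := fun V h hh hV hK =>
    hN V (T h) (hs _ hh).1 (singleton_subset_iff.1 (hs _ hh).2.1) hV hK
  have hadm : ∀ h, Admissible Subtype.val t h →
      Admissible (fun K : hyperspaceOf X => {(K : NonemptyCompacts Z)}) s (T h) := fun h hh => by
    induction h with
    | nil => exact trivial
    | cons V h ih =>
      obtain ⟨h₁, h₂, h₃⟩ := hTN V h (ih hh.1) hh.2.1 hh.2.2.1
      exact ⟨ih hh.1, h₁, singleton_subset_iff.2 h₂,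
        (subset_closure.trans h₃).trans inter_subset_left⟩
  refine ⟨t, fun h hh => ?_, fun V hV => ?_⟩
  · rcases h with _ | ⟨V, h⟩
    · exact ⟨isOpen_univ, subset_univ _, fun V hV => by simp at hV⟩
    · refine ⟨hh.2.1, ?_, fun V' hV' => ?_⟩
      · have h₁ := (hs _ (hadm _ hh)).2.2 _ rfl (singleton_subset_iff.1 (hs _ (hadm _ hh)).2.1)
        exact ((hTN V h (hadm h hh.1) hh.2.1 hh.2.2.1).2.2 (subset_closure h₁)).2
      · obtain rfl : V = V' := by simpa using hV'
        exact subset_rfl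
  rintro ⟨-, hVX⟩
  let 𝒱 : ℕ → Set (NonemptyCompacts Z) := fun n => N (V n) (T (history V n))
  have hhist : ∀ n, history 𝒱 n = T (history V n) := fun n => by
    induction n with
    | zero => rfl
    | succ n ih => exact congrArg (𝒱 n :: ·) ih
  have hadm𝒱 : ∀ n, Admissible (fun K : hyperspaceOf X => {(K : NonemptyCompacts Z)}) s
      (history 𝒱 n) := fun n => hhist n ▸ hadm _ (hV n)
  have h𝒱 : ∀ n, (𝒱 n).Nonempty ∧
      closure (𝒱 n) ⊆ (s (history 𝒱 n)).2 ∩ {K | (K : Set Z) ⊆ V n} := fun n => by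
    have := hTN (V n) (history V n) (hadm _ (hV n)) (hV (n + 1)).2.1 (hV (n + 1)).2.2.1
    rw [hhist n]
    exact ⟨⟨_, this.2.1⟩, this.2.2⟩
  have hsucc : ∀ n, (s (history 𝒱 (n + 1))).2 ⊆ 𝒱 n := fun n =>
    (hs _ (hadm𝒱 (n + 1))).2.2 _ rfl
  have hne : (⋂ n, (s (history 𝒱 n)).2).Nonempty :=
    (IsCompact.nonempty_iInter_of_sequence_nonempty_isCompact_isClosed
      (fun n => closure (𝒱 n))
      (fun n => ((h𝒱 (n + 1)).2.trans inter_subset_left).trans ((hsucc n).trans subset_closure))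
      (fun n => (h𝒱 n).1.closure) isClosed_closure.isCompact fun n => isClosed_closure).mono
    (iInter_mono fun n => (h𝒱 n).2.trans inter_subset_left)
  obtain ⟨L, hL, hLX⟩ := not_subset.1 fun h => hwin 𝒱 hadm𝒱 ⟨hne, h⟩
  refine hLX fun z hz => hVX (mem_iInter.2 fun n => ?_)
  rcases n with _ | n
  · exact mem_univ z
  · exact ((h𝒱 n).2 (subset_closure (hsucc n (mem_iInter.1 hL (n + 1))))).2 hz

end PoradaGame

theorem theorem3p3 {Z : Type*} [TopologicalSpace Z] [CompactSpace Z] [T2Space Z] (X : Set Z) :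
    List.TFAE
      [PoradaGame.PlayerIWinsKPorada X,
       PoradaGame.PlayerIWinsPorada (hyperspaceOf X),
       PoradaGame.PlayerIWinsKPorada (hyperspaceOf X),
       ¬ IsMengerSpace ((Xᶜ : Set Z) : Type _),
       ¬ IsMengerSpace (((hyperspaceOf X)ᶜ : Set (TopologicalSpace.NonemptyCompacts Z)) : Type _)] := by
  tfae_have 1 → 4 := PoradaGame.PlayerIWinsKPorada.not_isMengerSpace
  tfae_have 4 → 2 := PoradaGame.playerIWinsPorada_hyperspaceOf
  tfae_have 2 → 1 := PoradaGame.PlayerIWinsPorada.playerIWinsKPorada_of_hyperspaceOf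
  tfae_have 2 → 3 := PoradaGame.PlayerIWinsPorada.playerIWinsKPorada
  tfae_have 3 → 5 := PoradaGame.PlayerIWinsKPorada.not_isMengerSpace
  tfae_have 5 → 4 := mt IsMengerSpace.compl_hyperspaceOf
  tfae_finish
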